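/- There are absolute constants $c_1,c_2>0$ such that the following holds for every dimension $d$. Let $D$ be a log-concave probability distribution on $\mathbb{R}^d$, that is, one having a density with respect to Lebesgue measure of the form $e^{g(x)}$ with $g:\mathbb{R}^d\to[-\infty,\infty)$ concave (and $e^{-\infty}=0$). Then there is an invertible affine map $T:\mathbb{R}^d\to\mathbb{R}^d$ such that the image distribution $D'$ of $D$ under $T$ satisfies, with $\|\cdot\|$ the Euclidean norm, 1. (concentration) $\Pr_{x\sim D'}\big[\|x\|>d\alpha\big]\le \dfrac{c_1}{\alpha}$ for all $\alpha>0$; 2. (strip anti-concentration) $\Pr_{x\sim D'}\big[|\langle x,v\rangle+b|\le\alpha\big]\le c_2\,\alpha$ for all $\alpha>0$, all unit vectors $v\in\mathbb{R}^d$ and all $b\in\mathbb{R}$. -/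

import Mathlib

open MeasureTheory

/-- `μ` has a density of the form `exp ∘ g` with `g` concave. The function `g` may take the value
`-∞`: it is real valued and concave on a convex set `s`, and the density vanishes outside `s`. -/
def IsLogConcave {d : ℕ} (μ : Measure (EuclideanSpace ℝ (Fin d))) : Prop :=
  ∃ (s : Set (EuclideanSpace ℝ (Fin d))) (g : EuclideanSpace ℝ (Fin d) → ℝ),
    ConcaveOn ℝ s g ∧
    AEMeasurable (s.indicator fun x => ENNReal.ofReal (Real.exp (g x))) volume ∧
    μ = volume.withDensity (s.indicator fun x => ENNReal.ofReal (Real.exp (g x)))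

/-- `ν` is the image of `μ` under an invertible affine map. -/
def AffinelyEquivalent {d : ℕ} (μ ν : Measure (EuclideanSpace ℝ (Fin d))) : Prop :=
  ∃ T : EuclideanSpace ℝ (Fin d) ≃ᵃ[ℝ] EuclideanSpace ℝ (Fin d), ν = μ.map T

/-- The concentration condition: `Pr[‖x‖ > d α] ≤ c₁ / α` for all `α > 0`. -/
def Concentrated {d : ℕ} (c₁ : ℝ) (ν : Measure (EuclideanSpace ℝ (Fin d))) : Prop :=
  ∀ α : ℝ, 0 < α → ν.real {x | (d : ℝ) * α < ‖x‖} ≤ c₁ / α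

/-- The strip anti-concentration condition: `Pr[|⟨x, v⟩ + b| ≤ α] ≤ c₂ α` for all `α > 0` and all
hyperplanes with unit normal vector `v` and offset `b`. -/
def StripAntiConcentrated {d : ℕ} (c₂ : ℝ) (ν : Measure (EuclideanSpace ℝ (Fin d))) : Prop :=
  ∀ α : ℝ, 0 < α → ∀ (v : EuclideanSpace ℝ (Fin d)) (b : ℝ), ‖v‖ = 1 →
    ν.real {x | |inner ℝ x v + b| ≤ α} ≤ c₂ * α

open scoped ENNReal
open ProbabilityTheory

/-! Take `T` to the isotropic position: mean zero, identity covariance. Then `E‖x‖² = d`, and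
Chebyshev gives concentration with constant 1. For strips, every unit direction has a marginal of
variance 1. Prékopa-Leindler makes half-space masses log-concave in the offset
(`IsLogConcave.measure_mul_measure_le`), so a strip of width `δ` and mass `p` forces geometric decay
`(1 - p)^n` at distance `n * δ` on both sides. Summing tails bounds the second moment about the
strip's edge by `4δ²/p²` (`IsLogConcave.lintegral_sq_le`); variance 1 then yields `p ≤ 2δ`. The same
bound makes second moments finite, and absolute continuity makes the covariance nondegenerate, so
the isotropic position exists (`IsLogConcave.exists_isotropic`). -/

/-! ### The Prékopa-Leindler inequality -/

theorem ENNReal.mul_le_sq_of_add_le_two_mul {a b c : ℝ≥0∞} (h : a + b ≤ 2 * c) :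
    a * b ≤ c ^ 2 := by
  rcases eq_or_ne c ⊤ with rfl | hc
  · simp
  have hab : a + b ≠ ⊤ := ne_top_of_le_ne_top (ENNReal.mul_ne_top (by simp) hc) h
  obtain ⟨ha, hb⟩ := ENNReal.add_ne_top.1 hab
  lift a to NNReal using ha
  lift b to NNReal using hb
  lift c to NNReal using hc
  have h' : (a : ℝ) + b ≤ 2 * c := by exact_mod_cast h
  have : (a : ℝ) * b ≤ c ^ 2 := by
    nlinarith [sq_nonneg ((a : ℝ) - b), a.coe_nonneg, b.coe_nonneg, c.coe_nonneg]
  exact_mod_cast this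

/-- One-dimensional Brunn-Minkowski inequality for compact sets. -/
theorem volume_add_volume_le_of_isCompact {K L C : Set ℝ} (hK : IsCompact K) (hL : IsCompact L)
    (hK' : K.Nonempty) (hL' : L.Nonempty) (h : ∀ x ∈ K, ∀ y ∈ L, x + y ∈ C) :
    volume K + volume L ≤ volume C := by
  obtain ⟨a, haK, ha⟩ := hK.exists_isGreatest hK'
  obtain ⟨b, hbL, hb⟩ := hL.exists_isLeast hL'
  have e1 : volume ((fun x => x + -b) ⁻¹' K) = volume K := measure_preimage_add_right _ _ _
  have e2 : volume ((fun x => x + -a) ⁻¹' L) = volume L := measure_preimage_add_right _ _ _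
  -- With `a = max K` and `b = min L`, the translate `K + b` lies left of `a + b` and `L + a` lies
  -- right of it.
  have hd : AEDisjoint volume ((fun x => x + -b) ⁻¹' K) ((fun x => x + -a) ⁻¹' L) := by
    refine measure_mono_null (t := {a + b}) ?_ (by simp)
    rintro x ⟨h1, h2⟩
    have h3 := ha h1
    have h4 := hb h2
    simp only [Set.mem_singleton_iff]
    linarith
  have hm : MeasurableSet ((fun x => x + -a) ⁻¹' L) :=
    hL.measurableSet.preimage (measurable_id.add_const _)
  rw [← e1, ← e2, ← measure_union₀ hm.nullMeasurableSet hd]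
  refine measure_mono ?_
  rintro x (hx | hx)
  · simpa using h _ hx _ hbL
  · simpa using h _ haK _ hx

/-- One-dimensional Brunn-Minkowski inequality. -/
theorem volume_add_volume_le {A B C : Set ℝ} (hA : MeasurableSet A) (hB : MeasurableSet B)
    (hA' : A.Nonempty) (hB' : B.Nonempty) (h : ∀ x ∈ A, ∀ y ∈ B, x + y ∈ C) :
    volume A + volume B ≤ volume C := by
  obtain ⟨a, ha⟩ := hA'
  obtain ⟨b, hb⟩ := hB'
  rw [hA.measure_eq_iSup_isCompact, hB.measure_eq_iSup_isCompact]
  simp only [iSup_and']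
  refine ENNReal.biSup_add_biSup_le' ⟨∅, by simp⟩ ⟨∅, by simp⟩ ?_
  rintro K ⟨hKA, hK⟩ L ⟨hLB, hL⟩
  -- The inserted points keep the approximating compact sets nonempty.
  calc volume K + volume L ≤ volume (insert a K) + volume (insert b L) :=
        add_le_add (measure_mono (Set.subset_insert _ _)) (measure_mono (Set.subset_insert _ _))
    _ ≤ volume C := by
        refine volume_add_volume_le_of_isCompact (hK.insert a) (hL.insert b)
          (Set.insert_nonempty _ _) (Set.insert_nonempty _ _) fun x hx y hy => h x ?_ y ?_
        · exact Set.insert_subset ha hKA hx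
        · exact Set.insert_subset hb hLB hy

theorem lintegral_eq_setLIntegral_meas_lt_of_le_one {f : ℝ → ℝ≥0∞} (hf : Measurable f)
    (hf1 : ∀ x, f x ≤ 1) :
    ∫⁻ x, f x = ∫⁻ t in Set.Ioo (0 : ℝ) 1, volume {x | ENNReal.ofReal t < f x} := by
  have hfin : ∀ x, f x ≠ ⊤ := fun x => ne_top_of_le_ne_top ENNReal.one_ne_top (hf1 x)
  have h1 := lintegral_eq_lintegral_meas_lt (volume : Measure ℝ) (f := fun x => (f x).toReal)
    (ae_of_all _ fun x => ENNReal.toReal_nonneg) hf.ennreal_toReal.aemeasurable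
  simp only [ENNReal.ofReal_toReal (hfin _)] at h1
  rw [h1, ← Set.Ioo_union_Ici_eq_Ioi (zero_lt_one' ℝ), lintegral_union measurableSet_Ici]
  · have : ∫⁻ t in Set.Ici (1 : ℝ), volume {x | t < (f x).toReal} = 0 := by
      rw [setLIntegral_congr_fun (g := fun _ => 0) measurableSet_Ici]
      · simp
      · intro t ht
        have : {x | t < (f x).toReal} = ∅ := by
          ext x
          have := ENNReal.toReal_mono ENNReal.one_ne_top (hf1 x)
          simp only [Set.mem_ofPred_eq, Set.mem_empty_iff_false, iff_false, not_lt]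
          exact this.trans (by simpa using ht)
        simp [this]
    rw [this, add_zero]
    refine setLIntegral_congr_fun measurableSet_Ioo fun t ht => ?_
    simp only [ENNReal.ofReal_lt_iff_lt_toReal ht.1.le (hfin _)]
  · exact Set.disjoint_left.2 fun x hx hx' => absurd hx.2 (not_lt.2 hx')

/-- Midpoints of `{f > t}` and `{g > t}` lie in `{h > t}`. For `t < 1` both sets are nonempty, so
one-dimensional Brunn-Minkowski applies level by level; integrate over `t`. -/
theorem lintegral_add_lintegral_le_of_le_one {f g h : ℝ → ℝ≥0∞} (hf : Measurable f)
    (hg : Measurable g) (hh : Measurable h) (hf1 : ∀ x, f x ≤ 1) (hg1 : ∀ x, g x ≤ 1)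
    (hf' : ∀ t < 1, ∃ x, t < f x) (hg' : ∀ t < 1, ∃ x, t < g x)
    (H : ∀ x y, f x * g y ≤ h ((1 / 2 : ℝ) • (x + y)) ^ 2) :
    (∫⁻ x, f x) + ∫⁻ x, g x ≤ 2 * ∫⁻ x, h x := by
  have hh' : Measurable fun x => min (h x) 1 := hh.min measurable_const
  have hmono : ∫⁻ x, min (h x) 1 ≤ ∫⁻ x, h x := lintegral_mono fun x => min_le_left _ _
  refine le_trans ?_ (mul_le_mul_right hmono 2)
  rw [lintegral_eq_setLIntegral_meas_lt_of_le_one hf hf1,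
    lintegral_eq_setLIntegral_meas_lt_of_le_one hg hg1,
    lintegral_eq_setLIntegral_meas_lt_of_le_one hh' fun x => min_le_right _ _,
    ← lintegral_const_mul' _ _ (by simp), ← lintegral_add_left]
  · refine setLIntegral_mono' measurableSet_Ioo fun t ht => ?_
    have ht1 : ENNReal.ofReal t < 1 := by simpa using ht.2
    have key := volume_add_volume_le (C := (fun x => (1 / 2 : ℝ) * x) ⁻¹'
        {x | ENNReal.ofReal t < min (h x) 1})
      (measurableSet_lt measurable_const hf) (measurableSet_lt measurable_const hg)
      (hf' _ ht1) (hg' _ ht1) (fun x hx y hy => ?_)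
    · rw [Real.volume_preimage_mul_left (by norm_num)] at key
      simpa using key
    · refine lt_min ?_ ht1
      have h1 : ENNReal.ofReal t ^ 2 < h ((1 / 2 : ℝ) • (x + y)) ^ 2 := by
        refine lt_of_lt_of_le ?_ (H x y)
        rw [sq]
        exact ENNReal.mul_lt_mul hx hy
      exact (pow_left_mono 2).reflect_lt h1
  · refine Antitone.measurable fun s t hst => measure_mono fun x hx => ?_
    exact lt_of_le_of_lt (ENNReal.ofReal_le_ofReal hst) hx

/-- The Prékopa-Leindler inequality for the midpoint holds for the measure `μ`. -/
def MidpointPrekopaLeindler {E : Type*} [AddCommGroup E] [Module ℝ E] [MeasurableSpace E]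
    (μ : Measure E) : Prop :=
  ∀ f g h : E → ℝ≥0∞, Measurable f → Measurable g → Measurable h →
    (∀ x y, f x * g y ≤ h ((1 / 2 : ℝ) • (x + y)) ^ 2) →
    (∫⁻ x, f x ∂μ) * ∫⁻ x, g x ∂μ ≤ (∫⁻ x, h x ∂μ) ^ 2

/-- Divide `f`, `g` by their suprema `F`, `G`, and `h` by `√(FG)`; the additive inequality followed
by AM-GM gives the product form. -/
theorem lintegral_mul_lintegral_le_sq_of_bounded {f g h : ℝ → ℝ≥0∞} (hf : Measurable f)
    (hg : Measurable g) (hh : Measurable h) {M : ℝ≥0∞} (hM : M ≠ ⊤) (hfM : ∀ x, f x ≤ M)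
    (hgM : ∀ x, g x ≤ M) (H : ∀ x y, f x * g y ≤ h ((1 / 2 : ℝ) • (x + y)) ^ 2) :
    (∫⁻ x, f x) * ∫⁻ x, g x ≤ (∫⁻ x, h x) ^ 2 := by
  have hsup : ∀ u : ℝ → ℝ≥0∞, (∀ x, u x ≤ M) → (⨆ x, u x) ≠ ⊤ := fun u hu =>
    ne_top_of_le_ne_top hM (iSup_le hu)
  have hFt := hsup f hfM
  have hGt := hsup g hgM
  set F := ⨆ x, f x with hF
  set G := ⨆ x, g x with hG
  rcases eq_or_ne F 0 with hF0 | hF0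
  · have : ∀ x, f x = 0 := by simpa [hF] using hF0
    simp [this]
  rcases eq_or_ne G 0 with hG0 | hG0
  · have : ∀ x, g x = 0 := by simpa [hG] using hG0
    simp [this]
  set S : ℝ≥0∞ := (F * G) ^ (1 / 2 : ℝ) with hS
  have hS2 : S ^ 2 = F * G := by
    rw [hS, ← ENNReal.rpow_natCast, ← ENNReal.rpow_mul]
    norm_num
  have hFG0 : F * G ≠ 0 := mul_ne_zero hF0 hG0
  have hFGt : F * G ≠ ⊤ := ENNReal.mul_ne_top hFt hGt
  have hsup1 : ∀ (u : ℝ → ℝ≥0∞) (U : ℝ≥0∞), U = ⨆ x, u x → U ≠ 0 → U ≠ ⊤ →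
      ∀ t < 1, ∃ x, t < u x * U⁻¹ := by
    intro u U hU hU0 hUt t ht
    have : t * U < ⨆ x, u x := by
      rw [← hU]
      calc t * U < 1 * U := (ENNReal.mul_lt_mul_iff_left hU0 hUt).2 ht
        _ = U := one_mul _
    obtain ⟨x, hx⟩ := lt_iSup_iff.1 this
    refine ⟨x, ?_⟩
    rwa [← div_eq_mul_inv, ENNReal.lt_div_iff_mul_lt (Or.inl hU0) (Or.inl hUt)]
  have key := lintegral_add_lintegral_le_of_le_one (hf.mul_const F⁻¹) (hg.mul_const G⁻¹)
    (hh.mul_const S⁻¹) (fun x => ?_) (fun x => ?_) (hsup1 f F hF hF0 hFt) (hsup1 g G hG hG0 hGt)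
    (fun x y => ?_)
  · rw [lintegral_mul_const _ hf, lintegral_mul_const _ hg, lintegral_mul_const _ hh] at key
    have k2 := ENNReal.mul_le_sq_of_add_le_two_mul key
    rw [mul_pow, ← ENNReal.inv_pow, hS2, mul_mul_mul_comm,
      ← ENNReal.mul_inv (Or.inl hF0) (Or.inl hFt)] at k2
    exact (ENNReal.mul_le_mul_iff_left (ENNReal.inv_ne_zero.2 hFGt)
      (ENNReal.inv_ne_top.2 hFG0)).1 k2
  · rw [← div_eq_mul_inv]
    exact ENNReal.div_le_of_le_mul (by rw [one_mul]; exact le_iSup f x)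
  · rw [← div_eq_mul_inv]
    exact ENNReal.div_le_of_le_mul (by rw [one_mul]; exact le_iSup g x)
  · rw [mul_pow, ← ENNReal.inv_pow, hS2, mul_mul_mul_comm,
      ← ENNReal.mul_inv (Or.inl hF0) (Or.inl hFt)]
    exact mul_le_mul_left (H x y) _

theorem midpointPrekopaLeindler_real : MidpointPrekopaLeindler (volume : Measure ℝ) := by
  intro f g h hf hg hh H
  have hlim : ∀ u : ℝ → ℝ≥0∞, Measurable u →
      ∫⁻ x, u x = ⨆ n : ℕ, ∫⁻ x, min (u x) n := by
    intro u hu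
    rw [← lintegral_iSup (fun n => hu.min measurable_const)]
    · congr 1 with x
      rw [← inf_iSup_eq, ENNReal.iSup_natCast, inf_top_eq]
    · intro m n hmn x
      exact min_le_min le_rfl (by exact_mod_cast hmn)
  rw [hlim f hf, hlim g hg, ENNReal.iSup_mul]
  refine iSup_le fun m => ?_
  rw [ENNReal.mul_iSup]
  refine iSup_le fun n => ?_
  refine lintegral_mul_lintegral_le_sq_of_bounded (hf.min measurable_const)
    (hg.min measurable_const) hh (M := (max m n : ℕ)) (by simp) (fun x => ?_) (fun x => ?_)
    fun x y => (mul_le_mul' (min_le_left _ _) (min_le_left _ _)).trans (H x y)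
  · exact (min_le_right _ _).trans (by exact_mod_cast le_max_left m n)
  · exact (min_le_right _ _).trans (by exact_mod_cast le_max_right m n)

/-- Tensorisation: the inequality on fibres says that the fibre integrals satisfy the hypothesis on
the base. -/
theorem MidpointPrekopaLeindler.prod {E F : Type*} [AddCommGroup E] [Module ℝ E]
    [MeasurableSpace E] [AddCommGroup F] [Module ℝ F] [MeasurableSpace F] {μ : Measure E}
    {ν : Measure F} [SFinite ν] (hμ : MidpointPrekopaLeindler μ)
    (hν : MidpointPrekopaLeindler ν) : MidpointPrekopaLeindler (μ.prod ν) := by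
  intro f g h hf hg hh H
  rw [lintegral_prod _ hf.aemeasurable, lintegral_prod _ hg.aemeasurable,
    lintegral_prod _ hh.aemeasurable]
  refine hμ _ _ _ hf.lintegral_prod_right' hg.lintegral_prod_right' hh.lintegral_prod_right'
    fun x y => ?_
  exact hν _ _ _ (hf.comp measurable_prodMk_left) (hg.comp measurable_prodMk_left)
    (hh.comp measurable_prodMk_left) fun u v => H (x, u) (y, v)

theorem MidpointPrekopaLeindler.of_measurePreserving {E F : Type*} [AddCommGroup E] [Module ℝ E]
    [MeasurableSpace E] [AddCommGroup F] [Module ℝ F] [MeasurableSpace F] {μ : Measure E}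
    {ν : Measure F} (hμ : MidpointPrekopaLeindler μ) (e : E →ₗ[ℝ] F)
    (he : MeasurePreserving e μ ν) : MidpointPrekopaLeindler ν := by
  intro f g h hf hg hh H
  rw [← he.lintegral_comp hf, ← he.lintegral_comp hg, ← he.lintegral_comp hh]
  refine hμ _ _ _ (hf.comp he.measurable) (hg.comp he.measurable) (hh.comp he.measurable)
    fun x y => ?_
  simpa using H (e x) (e y)

theorem midpointPrekopaLeindler_pi (d : ℕ) :
    MidpointPrekopaLeindler (volume : Measure (Fin d → ℝ)) := by
  induction d with
  | zero =>
    intro f g h hf hg hh H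
    simp only [lintegral_unique, volume_pi, Measure.pi_univ, Finset.univ_eq_empty,
      Finset.prod_empty, mul_one]
    convert H default default
  | succ d ih =>
    have h := (volume_preserving_piFinSuccAbove (fun _ : Fin (d + 1) => ℝ) 0).symm
    refine (midpointPrekopaLeindler_real.prod ih).of_measurePreserving
      (Fin.consLinearEquiv ℝ fun _ : Fin (d + 1) => ℝ).toLinearMap ?_
    have e : ⇑(Fin.consLinearEquiv ℝ fun _ : Fin (d + 1) => ℝ).toLinearMap =
        (MeasurableEquiv.piFinSuccAbove (fun _ : Fin (d + 1) => ℝ) 0).symm := by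
      funext x
      simp [MeasurableEquiv.piFinSuccAbove, Fin.insertNthEquiv]
      rfl
    rw [e]
    exact h

/-- The Prékopa-Leindler inequality on Euclidean space, for the midpoint. -/
theorem midpointPrekopaLeindler_euclideanSpace (d : ℕ) :
    MidpointPrekopaLeindler (volume : Measure (EuclideanSpace ℝ (Fin d))) :=
  (midpointPrekopaLeindler_pi d).of_measurePreserving
    (WithLp.linearEquiv 2 ℝ (Fin d → ℝ)).symm.toLinearMap
    (EuclideanSpace.volume_preserving_symm_measurableEquiv_toLp (Fin d)).symm

/-! ### Brunn-Minkowski for log-concave measures -/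

/-- Cutting down to `interior s` costs only the null frontier of a convex set, and there `g` is
continuous, so the new density is Borel. -/
theorem IsLogConcave.exists_density {d : ℕ} {μ : Measure (EuclideanSpace ℝ (Fin d))}
    (hμ : IsLogConcave μ) :
    ∃ ρ : EuclideanSpace ℝ (Fin d) → ℝ≥0∞, Measurable ρ ∧ μ = volume.withDensity ρ ∧
      ∀ x y, ρ x * ρ y ≤ ρ ((1 / 2 : ℝ) • (x + y)) ^ 2 := by
  obtain ⟨s, g, hg, -, rfl⟩ := hμ
  have hs : Convex ℝ s := hg.1
  refine ⟨(interior s).indicator fun x => ENNReal.ofReal (Real.exp (g x)), ?_, ?_, ?_⟩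
  · have hc : ContinuousOn (fun x => ENNReal.ofReal (Real.exp (g x))) (interior s) :=
      ENNReal.continuous_ofReal.comp_continuousOn
        (Real.continuous_exp.comp_continuousOn hg.continuousOn_interior)
    classical
    rw [← Set.piecewise_eq_indicator]
    exact hc.measurable_piecewise continuousOn_const isOpen_interior.measurableSet
  · refine withDensity_congr_ae ?_
    have h0 := hs.addHaar_frontier volume
    filter_upwards [measure_eq_zero_iff_ae_notMem.1 h0] with x hx
    by_cases hxi : x ∈ interior s
    · rw [Set.indicator_of_mem hxi, Set.indicator_of_mem (interior_subset hxi)]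
    · rw [Set.indicator_of_notMem hxi, Set.indicator_of_notMem]
      exact fun hxs => hx ⟨subset_closure hxs, hxi⟩
  · intro x y
    by_cases hx : x ∈ interior s
    swap
    · simp [Set.indicator_of_notMem hx]
    by_cases hy : y ∈ interior s
    swap
    · simp [Set.indicator_of_notMem hy]
    have hxy : (1 / 2 : ℝ) • (x + y) ∈ interior s := by
      rw [smul_add]
      exact hs.interior hx hy (by norm_num) (by norm_num) (by norm_num)
    rw [Set.indicator_of_mem hx, Set.indicator_of_mem hy, Set.indicator_of_mem hxy,
      ← ENNReal.ofReal_mul (Real.exp_nonneg _), ← ENNReal.ofReal_pow (Real.exp_nonneg _),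
      ← Real.exp_add, ← Real.exp_nat_mul]
    refine ENNReal.ofReal_le_ofReal (Real.exp_le_exp.2 ?_)
    have := hg.2 (interior_subset hx) (interior_subset hy) (by norm_num : (0 : ℝ) ≤ 1 / 2)
      (by norm_num : (0 : ℝ) ≤ 1 / 2) (by norm_num)
    rw [← smul_add, ← smul_add, smul_eq_mul] at this
    push_cast
    linarith

theorem IsLogConcave.absolutelyContinuous {d : ℕ} {μ : Measure (EuclideanSpace ℝ (Fin d))}
    (hμ : IsLogConcave μ) : μ ≪ volume := by
  obtain ⟨ρ, -, rfl, -⟩ := hμ.exists_density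
  exact withDensity_absolutelyContinuous _ _

/-- Log-concave measures satisfy the multiplicative Brunn-Minkowski inequality for midpoints. -/
theorem IsLogConcave.measure_mul_measure_le {d : ℕ} {μ : Measure (EuclideanSpace ℝ (Fin d))}
    (hμ : IsLogConcave μ) {A B C : Set (EuclideanSpace ℝ (Fin d))} (hA : MeasurableSet A)
    (hB : MeasurableSet B) (hC : MeasurableSet C)
    (h : ∀ x ∈ A, ∀ y ∈ B, (1 / 2 : ℝ) • (x + y) ∈ C) : μ A * μ B ≤ μ C ^ 2 := by
  obtain ⟨ρ, hρ, rfl, H⟩ := hμ.exists_density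
  rw [withDensity_apply _ hA, withDensity_apply _ hB, withDensity_apply _ hC,
    ← lintegral_indicator hA, ← lintegral_indicator hB, ← lintegral_indicator hC]
  refine midpointPrekopaLeindler_euclideanSpace d _ _ _ (hρ.indicator hA) (hρ.indicator hB)
    (hρ.indicator hC) fun x y => ?_
  by_cases hx : x ∈ A
  swap
  · simp [Set.indicator_of_notMem hx]
  by_cases hy : y ∈ B
  swap
  · simp [Set.indicator_of_notMem hy]
  rw [Set.indicator_of_mem hx, Set.indicator_of_mem hy, Set.indicator_of_mem (h x hx y hy)]
  exact H x y

/-! ### Geometric tails and second moments -/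

/-- Log-concavity makes successive ratios decrease, and the first is at most `1 - p` because `G 0 ≤
1`. Monotonicity covers vanishing terms. -/
theorem le_one_sub_pow_of_logConcave {G : ℕ → ℝ} {p : ℝ} (hp : 0 ≤ p) (hG0 : ∀ n, 0 ≤ G n)
    (hG1 : G 0 ≤ 1) (hanti : Antitone G) (hlog : ∀ n, G n * G (n + 2) ≤ G (n + 1) ^ 2)
    (h01 : G 1 + p ≤ G 0) (n : ℕ) : G n ≤ (1 - p) ^ n := by
  have hp1 : p ≤ 1 := by linarith [hG0 1]
  have step : ∀ n, G (n + 1) ≤ (1 - p) * G n := by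
    intro n
    induction n with
    | zero => simp only [zero_add]; nlinarith
    | succ n ih =>
      rcases (hG0 n).eq_or_lt with h | h
      · have h1 : G (n + 1 + 1) ≤ 0 := (hanti (by omega : n ≤ n + 1 + 1)).trans_eq h.symm
        exact h1.trans (mul_nonneg (by linarith) (hG0 _))
      · refine le_of_mul_le_mul_left ?_ h
        calc G n * G (n + 2) ≤ G (n + 1) * G (n + 1) := by rw [← sq]; exact hlog n
          _ ≤ ((1 - p) * G n) * G (n + 1) := mul_le_mul_of_nonneg_right ih (hG0 _)
          _ = G n * ((1 - p) * G (n + 1)) := by ring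
  induction n with
  | zero => simpa using hG1
  | succ n ih =>
    rw [pow_succ']
    exact (step n).trans (mul_le_mul_of_nonneg_left ih (by linarith))

section Tails

variable {d : ℕ} {μ : Measure (EuclideanSpace ℝ (Fin d))} [IsProbabilityMeasure μ]

theorem IsLogConcave.measureReal_tail_le (hμ : IsLogConcave μ)
    (L : EuclideanSpace ℝ (Fin d) →L[ℝ] ℝ) (c : ℝ) {δ : ℝ} (hδ : 0 ≤ δ) (n : ℕ) :
    μ.real {x | c + n * δ ≤ L x} ≤ (1 - μ.real {x | c ≤ L x ∧ L x < c + δ}) ^ n := by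
  have hm : ∀ t : ℝ, MeasurableSet {x | t ≤ L x} := fun t =>
    measurableSet_le measurable_const L.measurable
  refine le_one_sub_pow_of_logConcave (G := fun n : ℕ => μ.real {x | c + n * δ ≤ L x})
    measureReal_nonneg (fun _ => measureReal_nonneg) measureReal_le_one ?_ ?_ ?_ n
  · intro m n hmn
    refine measureReal_mono fun x hx => ?_
    simp only [Set.mem_ofPred_eq] at hx ⊢
    have : (m : ℝ) ≤ n := by exact_mod_cast hmn
    nlinarith
  · intro n
    have := hμ.measure_mul_measure_le (hm (c + n * δ)) (hm (c + (n + 2 : ℕ) * δ))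
      (hm (c + (n + 1 : ℕ) * δ)) (fun x hx y hy => ?_)
    · simpa [Measure.real] using ENNReal.toReal_mono (by finiteness) this
    · simp only [Set.mem_ofPred_eq, map_smul, map_add, smul_eq_mul] at hx hy ⊢
      push_cast at *
      linarith
  · rw [← measureReal_union]
    · refine measureReal_mono ?_
      rintro x (hx | hx)
      · simp only [Set.mem_ofPred_eq] at hx ⊢
        push_cast at *
        linarith
      · simpa using hx.1
    · refine Set.disjoint_left.2 fun x hx hx' => ?_
      have h1 : c + ((1 : ℕ) : ℝ) * δ ≤ L x := hx
      have h2 : L x < c + δ := hx'.2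
      push_cast at h1
      linarith
    · exact (hm c).inter (measurableSet_lt L.measurable measurable_const)

/-- Starting at `c + δ` makes the first drop the same strip as for the upper tail. -/
theorem IsLogConcave.measureReal_lower_tail_le (hμ : IsLogConcave μ)
    (L : EuclideanSpace ℝ (Fin d) →L[ℝ] ℝ) (c : ℝ) {δ : ℝ} (hδ : 0 ≤ δ) (n : ℕ) :
    μ.real {x | L x < c + δ - n * δ} ≤ (1 - μ.real {x | c ≤ L x ∧ L x < c + δ}) ^ n := by
  have hm : ∀ t : ℝ, MeasurableSet {x | L x < t} := fun t =>
    measurableSet_lt L.measurable measurable_const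
  refine le_one_sub_pow_of_logConcave (G := fun n : ℕ => μ.real {x | L x < c + δ - n * δ})
    measureReal_nonneg (fun _ => measureReal_nonneg) measureReal_le_one ?_ ?_ ?_ n
  · intro m n hmn
    refine measureReal_mono fun x hx => ?_
    simp only [Set.mem_ofPred_eq] at hx ⊢
    have : (m : ℝ) ≤ n := by exact_mod_cast hmn
    nlinarith
  · intro n
    have := hμ.measure_mul_measure_le (hm (c + δ - n * δ)) (hm (c + δ - (n + 2 : ℕ) * δ))
      (hm (c + δ - (n + 1 : ℕ) * δ)) (fun x hx y hy => ?_)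
    · simpa [Measure.real] using ENNReal.toReal_mono (by finiteness) this
    · simp only [Set.mem_ofPred_eq, map_smul, map_add, smul_eq_mul] at hx hy ⊢
      push_cast at *
      linarith
  · rw [← measureReal_union]
    · refine measureReal_mono ?_
      rintro x (hx | hx)
      · simp only [Set.mem_ofPred_eq] at hx ⊢
        push_cast at *
        linarith
      · simpa using hx.2
    · refine Set.disjoint_left.2 fun x hx hx' => ?_
      have h1 : L x < c + δ - ((1 : ℕ) : ℝ) * δ := hx
      have h2 : c ≤ L x := hx'.1
      push_cast at h1
      linarith
    · exact (measurableSet_le measurable_const L.measurable).inter (hm _)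

theorem sum_range_two_mul_add_one (m : ℕ) : ∑ n ∈ Finset.range m, (2 * n + 1) = m ^ 2 := by
  induction m with
  | zero => simp
  | succ m ih => rw [Finset.sum_range_succ, ih]; ring

/-- A discrete layer-cake formula: with `m = ⌊|t|/δ⌋`, the odd numbers up to `2m + 1` sum to `(m +
1)²`, which exceeds `(t/δ)²`. -/
theorem ofReal_sq_le_tsum {δ : ℝ} (hδ : 0 < δ) (t : ℝ) :
    ENNReal.ofReal (t ^ 2) ≤ ENNReal.ofReal (δ ^ 2) *
      ∑' n : ℕ, ((2 * n + 1 : ℕ) : ℝ≥0∞) * {s : ℝ | n * δ ≤ |s|}.indicator 1 t := by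
  set m := ⌊|t| / δ⌋₊ with hm
  have h1 : |t| < (m + 1 : ℕ) * δ := by
    have := Nat.lt_floor_add_one (|t| / δ)
    rw [div_lt_iff₀ hδ] at this
    push_cast
    exact this
  have h2 : (m : ℝ) * δ ≤ |t| := by
    have := Nat.floor_le (div_nonneg (abs_nonneg t) hδ.le)
    rwa [le_div_iff₀ hδ] at this
  calc ENNReal.ofReal (t ^ 2) ≤ ENNReal.ofReal (δ ^ 2 * ((m + 1 : ℕ) ^ 2 : ℕ)) := by
        refine ENNReal.ofReal_le_ofReal ?_
        rw [← sq_abs]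
        push_cast at *
        nlinarith [abs_nonneg t]
    _ = ENNReal.ofReal (δ ^ 2) * (((m + 1) ^ 2 : ℕ) : ℝ≥0∞) := by
        rw [ENNReal.ofReal_mul (sq_nonneg _), ENNReal.ofReal_natCast]
    _ ≤ _ := by
        gcongr
        refine le_trans ?_ (ENNReal.sum_le_tsum (Finset.range (m + 1)))
        rw [← sum_range_two_mul_add_one, Nat.cast_sum]
        refine Finset.sum_le_sum fun n hn => ?_
        rw [Set.indicator_of_mem]
        · simp
        · have : (n : ℝ) ≤ m := by exact_mod_cast Finset.mem_range_succ_iff.1 hn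
          simp only [Set.mem_ofPred_eq]
          nlinarith

theorem tsum_ofReal_mul_geometric_le {p : ℝ} (hp : 0 < p) (hp1 : p ≤ 1) :
    ∑' n : ℕ, ((2 * n + 1 : ℕ) : ℝ≥0∞) * ENNReal.ofReal (2 * (1 - p) ^ n) ≤
      ENNReal.ofReal (4 / p ^ 2) := by
  have hq : ‖1 - p‖ < 1 := by rw [Real.norm_of_nonneg (by linarith)]; linarith
  have h1 := (hasSum_coe_mul_geometric_of_norm_lt_one hq).mul_left 4
  have h2 := (hasSum_geometric_of_norm_lt_one hq).mul_left 2
  have h3 := h1.add h2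
  have e : ∀ n : ℕ, ((2 * n + 1 : ℕ) : ℝ≥0∞) * ENNReal.ofReal (2 * (1 - p) ^ n) =
      ENNReal.ofReal (4 * (n * (1 - p) ^ n) + 2 * (1 - p) ^ n) := by
    intro n
    rw [← ENNReal.ofReal_natCast, ← ENNReal.ofReal_mul (by positivity)]
    congr 1
    push_cast
    ring
  simp only [e]
  rw [← ENNReal.ofReal_tsum_of_nonneg _ h3.summable, h3.tsum_eq]
  · refine ENNReal.ofReal_le_ofReal ?_
    have : 4 * ((1 - p) / (1 - (1 - p)) ^ 2) + 2 * (1 - (1 - p))⁻¹ = (4 - 2 * p) / p ^ 2 := by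
      rw [sub_sub_cancel]
      field_simp
      ring
    rw [this]
    gcongr
    linarith
  · intro n
    have : 0 ≤ 1 - p := by linarith
    positivity

/-- A one-dimensional marginal of a log-concave distribution cannot put mass `p` on an interval of
length `δ` unless its standard deviation is at most of order `δ / p`. -/
theorem IsLogConcave.lintegral_sq_le (hμ : IsLogConcave μ)
    (L : EuclideanSpace ℝ (Fin d) →L[ℝ] ℝ) (c : ℝ) {δ : ℝ} (hδ : 0 < δ)
    (hp : 0 < μ.real {x | c ≤ L x ∧ L x < c + δ}) :
    ∫⁻ x, ENNReal.ofReal ((L x - c) ^ 2) ∂μ ≤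
      ENNReal.ofReal (4 * δ ^ 2 / μ.real {x | c ≤ L x ∧ L x < c + δ} ^ 2) := by
  have hup := hμ.measureReal_tail_le L c hδ.le
  have hlow := hμ.measureReal_lower_tail_le L c hδ.le
  have hp1 : μ.real {x | c ≤ L x ∧ L x < c + δ} ≤ 1 := measureReal_le_one
  set p := μ.real {x | c ≤ L x ∧ L x < c + δ} with hpdef
  have hmeas : ∀ n : ℕ, MeasurableSet {s : ℝ | n * δ ≤ |s|} := fun n =>
    measurableSet_le measurable_const measurable_id.abs
  have htail : ∀ n : ℕ, ∫⁻ x, {s : ℝ | n * δ ≤ |s|}.indicator 1 (L x - c) ∂μ ≤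
      ENNReal.ofReal (2 * (1 - p) ^ n) := by
    intro n
    have hm : Measurable fun x => L x - c := L.measurable.sub_const c
    have e : ∫⁻ x, {s : ℝ | n * δ ≤ |s|}.indicator 1 (L x - c) ∂μ =
        μ {x | n * δ ≤ |L x - c|} := by
      exact lintegral_indicator_one (hm (hmeas n))
    rw [e, ← ofReal_measureReal]
    refine ENNReal.ofReal_le_ofReal ?_
    calc μ.real {x | n * δ ≤ |L x - c|}
        ≤ μ.real ({x | c + n * δ ≤ L x} ∪ {x | L x < c + δ - n * δ}) := by
          refine measureReal_mono fun x hx => ?_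
          simp only [Set.mem_ofPred_eq, Set.mem_union] at hx ⊢
          rcases le_abs.1 hx with h | h
          · left; linarith
          · right; linarith
      _ ≤ _ := measureReal_union_le _ _
      _ ≤ 2 * (1 - p) ^ n := by linarith [hup n, hlow n]
  calc ∫⁻ x, ENNReal.ofReal ((L x - c) ^ 2) ∂μ
      ≤ ∫⁻ x, ENNReal.ofReal (δ ^ 2) * ∑' n : ℕ, ((2 * n + 1 : ℕ) : ℝ≥0∞) *
          {s : ℝ | n * δ ≤ |s|}.indicator 1 (L x - c) ∂μ :=
        lintegral_mono fun x => ofReal_sq_le_tsum hδ _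
    _ = ENNReal.ofReal (δ ^ 2) * ∑' n : ℕ, ((2 * n + 1 : ℕ) : ℝ≥0∞) *
          ∫⁻ x, {s : ℝ | n * δ ≤ |s|}.indicator 1 (L x - c) ∂μ := by
        have hi : ∀ n : ℕ, Measurable fun x =>
            {s : ℝ | n * δ ≤ |s|}.indicator (1 : ℝ → ℝ≥0∞) (L x - c) := fun n =>
          (measurable_one.indicator (hmeas n)).comp (L.measurable.sub_const c)
        rw [lintegral_const_mul' _ _ ENNReal.ofReal_ne_top, lintegral_tsum]
        · congr 1
          refine tsum_congr fun n => ?_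
          rw [lintegral_const_mul' _ _ (ENNReal.natCast_ne_top _)]
        · exact fun n => ((hi n).const_mul _).aemeasurable
    _ ≤ ENNReal.ofReal (δ ^ 2) * ENNReal.ofReal (4 / p ^ 2) := by
        gcongr
        refine le_trans (ENNReal.tsum_le_tsum fun n => ?_) (tsum_ofReal_mul_geometric_le hp hp1)
        gcongr
        exact htail n
    _ = ENNReal.ofReal (4 * δ ^ 2 / p ^ 2) := by
        rw [← ENNReal.ofReal_mul (sq_nonneg _)]
        congr 1
        ring

end Tails

/-! ### Finite, nondegenerate variance and strip bounds -/

section Variance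

variable {d : ℕ} {μ : Measure (EuclideanSpace ℝ (Fin d))} [IsProbabilityMeasure μ]

theorem exists_measureReal_strip_pos (L : EuclideanSpace ℝ (Fin d) →L[ℝ] ℝ) :
    ∃ c δ : ℝ, 0 < δ ∧ 0 < μ.real {x | c ≤ L x ∧ L x < c + δ} := by
  by_contra! h
  have h0 : ∀ n : ℤ, μ {x | (n : ℝ) ≤ L x ∧ L x < n + 1} = 0 := by
    intro n
    have := le_antisymm (h n 1 one_pos) measureReal_nonneg
    rwa [measureReal_eq_zero_iff] at this
  have h1 : μ Set.univ = 0 := by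
    refine measure_mono_null (fun x _ => ?_) (measure_iUnion_null h0)
    exact Set.mem_iUnion.2 ⟨⌊L x⌋, Int.floor_le _, Int.lt_floor_add_one _⟩
  simp at h1

theorem IsLogConcave.memLp_two (hμ : IsLogConcave μ) (L : EuclideanSpace ℝ (Fin d) →L[ℝ] ℝ) :
    MemLp L 2 μ := by
  obtain ⟨c, δ, hδ, hp⟩ := exists_measureReal_strip_pos (μ := μ) L
  have hsub : MemLp (fun x => L x - c) 2 μ := by
    have hm : AEStronglyMeasurable (fun x => L x - c) μ := by fun_prop
    rw [memLp_two_iff_integrable_sq hm]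
    refine ⟨hm.pow 2, ?_⟩
    rw [hasFiniteIntegral_iff_ofReal (ae_of_all _ fun x => sq_nonneg _)]
    exact (hμ.lintegral_sq_le L c hδ hp).trans_lt ENNReal.ofReal_lt_top
  convert hsub.add (memLp_const c) using 1
  funext x
  simp

theorem IsLogConcave.measureReal_strip_le (hμ : IsLogConcave μ)
    (L : EuclideanSpace ℝ (Fin d) →L[ℝ] ℝ) (hL : Var[L; μ] = 1) {α : ℝ} (hα : 0 < α) (b : ℝ) :
    μ.real {x | |L x + b| ≤ α} ≤ 6 * α := by
  -- The closed strip of width `2α` must fit in a half-open one; width `3α` suffices, and `p ≤ 2 *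
  -- 3α` gives the constant 6.
  set c : ℝ := -b - α with hc
  have hle : μ.real {x | |L x + b| ≤ α} ≤ μ.real {x | c ≤ L x ∧ L x < c + 3 * α} := by
    refine measureReal_mono fun x hx => ?_
    have := abs_le.1 (show |L x + b| ≤ α from hx)
    exact ⟨by linarith [this.1], by linarith [this.2]⟩
  refine hle.trans ?_
  rcases (measureReal_nonneg (μ := μ) (s := {x | c ≤ L x ∧ L x < c + 3 * α})).eq_or_lt with h | hp
  · rw [← h]; positivity
  have key := hμ.lintegral_sq_le L c (by positivity : 0 < 3 * α) hp
  set p := μ.real {x | c ≤ L x ∧ L x < c + 3 * α}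
  have hLm : MemLp (fun x => L x - c) 2 μ := (hμ.memLp_two L).sub (memLp_const c)
  rw [← ofReal_integral_eq_lintegral_ofReal hLm.integrable_sq
    (ae_of_all _ fun x => sq_nonneg _), ENNReal.ofReal_le_ofReal_iff (by positivity)] at key
  have hvar : (1 : ℝ) ≤ ∫ x, (L x - c) ^ 2 ∂μ := by
    rw [← hL, ← variance_sub_const (L.continuous.aestronglyMeasurable) c]
    exact variance_le_expectation_sq hLm.aestronglyMeasurable
  have h1 := hvar.trans key
  rw [le_div_iff₀ (by positivity), one_mul] at h1
  refine le_of_sq_le_sq ?_ (by positivity)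
  calc p ^ 2 ≤ _ := h1
    _ = (6 * α) ^ 2 := by ring

theorem volume_hyperplane_eq_zero {u : EuclideanSpace ℝ (Fin d)} (hu : u ≠ 0) (c : ℝ) :
    volume {x : EuclideanSpace ℝ (Fin d) | inner ℝ u x = c} = 0 := by
  rcases Set.eq_empty_or_nonempty {x : EuclideanSpace ℝ (Fin d) | inner ℝ u x = c} with h | ⟨y, hy⟩
  · rw [h, measure_empty]
  · have hK : (innerₛₗ ℝ u).ker ≠ ⊤ := fun h => by
      have : u ∈ (innerₛₗ ℝ u).ker := h ▸ Submodule.mem_top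
      simp at this
      exact hu this
    rw [← Measure.addHaar_submodule volume _ hK, ← measure_preimage_add_right volume y]
    congr 1
    ext x
    have hy' : inner ℝ u y = c := hy
    simp [inner_add_right, hy']

/-- Zero variance would put all the mass on a hyperplane, which is Lebesgue null. -/
theorem variance_inner_pos (hμ : μ ≪ volume) (h2 : MemLp id 2 μ)
    {u : EuclideanSpace ℝ (Fin d)} (hu : u ≠ 0) : 0 < Var[fun x => inner ℝ u x; μ] := by
  refine (variance_nonneg _ _).lt_of_ne' fun h0 => ?_
  have hm : MemLp (fun x : EuclideanSpace ℝ (Fin d) => inner ℝ u x) 2 μ := h2.const_inner u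
  have h1 := ofReal_variance hm
  rw [h0, ENNReal.ofReal_zero, eq_comm, evariance_eq_zero_iff hm.aestronglyMeasurable.aemeasurable]
    at h1
  have h3 := hμ (volume_hyperplane_eq_zero hu (μ[fun x => inner ℝ u x]))
  have : ∀ᵐ x ∂μ, False := by
    filter_upwards [h1, measure_eq_zero_iff_ae_notMem.1 h3] with x hx hx'
    exact hx' hx
  exact IsProbabilityMeasure.ne_zero μ (by simpa using this)

end Variance

/-! ### Isotropic position -/

/-- A positive definite symmetric bilinear form has an orthonormal basis. -/
theorem LinearMap.BilinForm.exists_orthonormal_basis_of_pos {V : Type*} [AddCommGroup V]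
    [Module ℝ V] [FiniteDimensional ℝ V] {n : ℕ} (hn : Module.finrank ℝ V = n)
    (B : LinearMap.BilinForm ℝ V) (hs : B.IsSymm) (hpos : ∀ v, v ≠ 0 → 0 < B v v) :
    ∃ b : Module.Basis (Fin n) ℝ V, ∀ i j, B (b i) (b j) = if i = j then 1 else 0 := by
  subst hn
  obtain ⟨v, hv⟩ := LinearMap.BilinForm.exists_orthogonal_basis (K := ℝ) (B := B) ⟨hs.eq⟩
  have hvp : ∀ i, 0 < B (v i) (v i) := fun i => hpos _ (v.ne_zero i)
  refine ⟨v.isUnitSMul (w := fun i => (√(B (v i) (v i)))⁻¹) fun i =>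
    (inv_ne_zero (Real.sqrt_pos.2 (hvp i)).ne').isUnit, fun i j => ?_⟩
  simp only [Module.Basis.isUnitSMul_apply, map_smul, LinearMap.smul_apply, smul_eq_mul]
  split_ifs with h
  · subst h
    have h1 := Real.mul_self_sqrt (hvp i).le
    have h2 := (Real.sqrt_pos.2 (hvp i)).ne'
    field_simp
    rw [sq, h1]
  · have : B (v i) (v j) = 0 := hv h
    simp [this]

/-- A distribution with finite second moments and nondegenerate covariance has a basis in which
its coordinate functionals are uncorrelated with unit variance. -/
theorem exists_basis_variance_inner_sum {d : ℕ} {μ : Measure (EuclideanSpace ℝ (Fin d))}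
    [IsProbabilityMeasure μ] (h2 : MemLp id 2 μ)
    (hpos : ∀ u : EuclideanSpace ℝ (Fin d), u ≠ 0 → 0 < Var[fun x => inner ℝ u x; μ]) :
    ∃ b : Module.Basis (Fin d) ℝ (EuclideanSpace ℝ (Fin d)), ∀ v : EuclideanSpace ℝ (Fin d),
      Var[fun x => inner ℝ (∑ i, v i • b i) x; μ] = ‖v‖ ^ 2 := by
  obtain ⟨b, hb⟩ := LinearMap.BilinForm.exists_orthonormal_basis_of_pos
    (finrank_euclideanSpace_fin (𝕜 := ℝ) (n := d)) (covarianceBilin μ).toBilinForm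
    ⟨isPosSemidef_covarianceBilin.eq⟩ (fun u hu => by
      simpa [covarianceBilin_self h2] using hpos u hu)
  refine ⟨b, fun v => ?_⟩
  have hb' : ∀ i j, covarianceBilin μ (b i) (b j) = if i = j then 1 else 0 := hb
  rw [← covarianceBilin_self h2, EuclideanSpace.real_norm_sq_eq]
  simp [hb', sq]

/-- A log-concave distribution has an isotropic affine image. -/
theorem IsLogConcave.exists_isotropic {d : ℕ} {μ : Measure (EuclideanSpace ℝ (Fin d))}
    [IsProbabilityMeasure μ] (hμ : IsLogConcave μ) :
    ∃ T : EuclideanSpace ℝ (Fin d) ≃ᵃ[ℝ] EuclideanSpace ℝ (Fin d),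
      (Integrable (fun x => ‖T x‖ ^ 2) μ ∧ ∫ x, ‖T x‖ ^ 2 ∂μ = d) ∧
      ∀ v : EuclideanSpace ℝ (Fin d), ∃ (L : EuclideanSpace ℝ (Fin d) →L[ℝ] ℝ) (a : ℝ),
        Var[L; μ] = ‖v‖ ^ 2 ∧ ∀ x, inner ℝ (T x) v = L x + a := by
  have h2 : MemLp id 2 μ := MemLp.of_eval_piLp fun i =>
    hμ.memLp_two (EuclideanSpace.proj i : EuclideanSpace ℝ (Fin d) →L[ℝ] ℝ)
  obtain ⟨b, hb⟩ := exists_basis_variance_inner_sum h2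
    fun u hu => variance_inner_pos hμ.absolutelyContinuous h2 hu
  set A : EuclideanSpace ℝ (Fin d) →ₗ[ℝ] EuclideanSpace ℝ (Fin d) :=
    (WithLp.linearEquiv 2 ℝ (Fin d → ℝ)).symm.toLinearMap ∘ₗ
      LinearMap.pi fun i => innerₛₗ ℝ (b i) with hA
  have hAi : ∀ x i, A x i = inner ℝ (b i) x := fun x i => by simp [hA]
  have hinj : Function.Injective A := by
    refine (injective_iff_map_eq_zero A).2 fun x hx => ?_
    refine InnerProductSpace.ext_inner_left_basis b fun i => ?_
    rw [← hAi, hx]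
    simp
  -- `m` is the mean of the image under `A`; subtracting it turns second moments of coordinates into
  -- variances.
  set m : EuclideanSpace ℝ (Fin d) := WithLp.toLp 2 fun i => μ[fun x => inner ℝ (b i) x] with hm
  set T := (LinearEquiv.ofInjectiveEndo A hinj).toAffineEquiv.trans
    (AffineEquiv.constVAdd ℝ (EuclideanSpace ℝ (Fin d)) (-m)) with hT
  have hTi : ∀ x i, T x i = inner ℝ (b i) x - μ[fun x => inner ℝ (b i) x] := by
    intro x i
    have : T x = -m + A x := rfl
    rw [this, PiLp.add_apply, PiLp.neg_apply, hAi]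
    simp only [hm]
    ring
  have hL2 : ∀ i, MemLp (fun x => T x i) 2 μ := by
    intro i
    simp only [hTi]
    exact (h2.const_inner (b i)).sub (memLp_const _)
  refine ⟨T, ⟨?_, ?_⟩, fun v => ⟨innerSL ℝ (∑ i, v i • b i), -inner ℝ m v, ?_, fun x => ?_⟩⟩
  · simp only [EuclideanSpace.real_norm_sq_eq]
    exact integrable_finsetSum _ fun i _ => (hL2 i).integrable_sq
  · simp only [EuclideanSpace.real_norm_sq_eq]
    rw [integral_finsetSum _ fun i _ => (hL2 i).integrable_sq]
    have : ∀ i, ∫ x, T x i ^ 2 ∂μ = 1 := by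
      intro i
      have h := hb (EuclideanSpace.single i 1)
      simp only [PiLp.single_apply, ite_smul, one_smul, zero_smul,
        Finset.sum_ite_eq', Finset.mem_univ, if_true, PiLp.norm_single, norm_one,
        one_pow] at h
      rw [variance_eq_integral (by fun_prop)] at h
      simpa only [hTi] using h
    simp [this]
  · exact hb v
  · rw [PiLp.inner_apply (T x) v, PiLp.inner_apply m v]
    simp only [hTi, innerSL_apply_apply, sum_inner, hm]
    rw [← Finset.sum_neg_distrib, ← Finset.sum_add_distrib]
    refine Finset.sum_congr rfl fun i _ => ?_
    simp only [real_inner_smul_left, RCLike.inner_apply, conj_trivial]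
    ring

/-! ### Concentration and conclusion -/

theorem concentrated_map_of_integral_norm_sq {d : ℕ} {μ : Measure (EuclideanSpace ℝ (Fin d))}
    [IsProbabilityMeasure μ] {T : EuclideanSpace ℝ (Fin d) → EuclideanSpace ℝ (Fin d)}
    (hT : Measurable T) (hi : Integrable (fun x => ‖T x‖ ^ 2) μ)
    (hd : ∫ x, ‖T x‖ ^ 2 ∂μ = d) : Concentrated 1 (μ.map T) := by
  intro α hα
  rw [map_measureReal_apply hT (measurableSet_lt measurable_const measurable_norm)]
  rw [le_div_iff₀ hα]
  rcases Nat.eq_zero_or_pos d with rfl | hd0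
  · have : T ⁻¹' {x | ((0 : ℕ) : ℝ) * α < ‖x‖} = ∅ := by
      ext x
      simp [Subsingleton.elim (T x) 0]
    rw [this, measureReal_empty, zero_mul]
    exact zero_le_one
  set P := μ.real (T ⁻¹' {x | (d : ℝ) * α < ‖x‖}) with hP
  have hP0 : 0 ≤ P := measureReal_nonneg
  have hP1 : P ≤ 1 := measureReal_le_one
  -- For `α ≤ 1` the bound is trivial; beyond that, Chebyshev's `1/(dα²)` is at most `1/α`.
  rcases le_or_gt α 1 with h1 | h1
  · nlinarith
  have hd' : (1 : ℝ) ≤ d := by exact_mod_cast hd0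
  have hmark := mul_meas_ge_le_integral_of_nonneg (ae_of_all μ fun x => sq_nonneg ‖T x‖) hi
    ((d * α) ^ 2)
  have hle : P ≤ μ.real {x | (d * α) ^ 2 ≤ ‖T x‖ ^ 2} := by
    refine measureReal_mono fun x hx => ?_
    have hx' : d * α < ‖T x‖ := hx
    exact pow_le_pow_left₀ (by positivity) hx'.le 2
  rw [hd] at hmark
  have h3 : (d * α) ^ 2 * P ≤ d :=
    (mul_le_mul_of_nonneg_left hle (by positivity)).trans hmark
  have h4 : d * α ^ 2 * P ≤ 1 := by
    refine le_of_mul_le_mul_left ?_ (by positivity : (0 : ℝ) < d)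
    linarith
  calc P * α ≤ P * (d * α ^ 2) := by
        refine mul_le_mul_of_nonneg_left ?_ hP0
        nlinarith
    _ = d * α ^ 2 * P := by ring
    _ ≤ 1 := h4

theorem mainTheorem11 :
    ∃ c₁ c₂ : ℝ, 0 < c₁ ∧ 0 < c₂ ∧
      ∀ (d : ℕ) (μ : Measure (EuclideanSpace ℝ (Fin d))) [IsProbabilityMeasure μ],
        IsLogConcave μ →
          ∃ ν : Measure (EuclideanSpace ℝ (Fin d)),
            AffinelyEquivalent μ ν ∧ Concentrated c₁ ν ∧ StripAntiConcentrated c₂ ν := by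
  refine ⟨1, 6, one_pos, by norm_num, fun d μ _ hμ => ?_⟩
  obtain ⟨T, ⟨hi, hd⟩, hL⟩ := hμ.exists_isotropic
  have hT : Measurable T := (T.toAffineMap.continuous_of_finiteDimensional).measurable
  refine ⟨μ.map T, ⟨T, rfl⟩, concentrated_map_of_integral_norm_sq hT hi hd, ?_⟩
  intro α hα v b hv
  obtain ⟨L, a, hvar, hinner⟩ := hL v
  have hm : MeasurableSet {x : EuclideanSpace ℝ (Fin d) | |inner ℝ x v + b| ≤ α} :=
    (isClosed_le (by fun_prop) continuous_const).measurableSet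
  rw [map_measureReal_apply hT hm]
  have := hμ.measureReal_strip_le L (by rw [hvar, hv, one_pow]) hα (a + b)
  simpa only [Set.preimage_ofPred_eq, hinner, add_assoc] using this
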